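/- For a nonempty compact set $B\subset\mathbb R^2$ and a point $x$, let $c(x,B)$ denote a point of $B$ closest to $x$ (Euclidean distance); if there are several, every choice is used. For nonempty compact $A,B\subset\mathbb R^2$ and $\alpha\in[0,1]$ the Voronoi morph is $$T_\alpha(A,B)=\{a+\alpha(c(a,B)-a) : a\in A\}\cup\{b+(1-\alpha)(c(b,A)-b) : b\in B\}.$$ A polygonal shape is a nonempty compact set in the plane whose boundary is the disjoint union of finitely many points (vertices) and finitely many open segments joining two distinct vertices (open edges). Its faces are the connected components of its interior, and its sites are its vertices, open edges and faces. The Voronoi cell of a site $s$ of $B$ is the set of points that have a closest point of $B$ on $s$. The piece of $A$ at $s$ is the part of $A$ in this cell. For a piece $P$ at $s$, let $P_\alpha$ be the image of $P$ under scaling towards $s$ by $\alpha$: $x\mapsto x+\alpha(v-x)$ if $s$ is a vertex $v$; $x\mapsto x+\alpha(\pi(x)-x)$ if $s$ is an edge, where $\pi$ is the orthogonal projection to its supporting line; and $x\mapsto x$ if $s$ is a face. Two sets are interior-disjoint if their interiors are disjoint. (1) Let $A,B$ be polygonal shapes and $\alpha\in[0,1]$. The pieces $P$ of $A$ at the sites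 of $B$ cover $A$, the pieces $Q$ of $B$ at the sites of $A$ cover $B$, and $T_\alpha(A,B)$ is the union of all the sets $P_\alpha$ and $Q_{1-\alpha}$. Moreover: (a) for pieces $P,P'$ of $A$ at different sites of $B$, $P_\alpha$ and $P'_\alpha$ are interior-disjoint; for pieces $Q,Q'$ of $B$ at different sites of $A$, $Q_{1-\alpha}$ and $Q'_{1-\alpha}$ are interior-disjoint; (b) for a piece $P$ of $A$ and a piece $Q$ of $B$, $P_\alpha$ and $Q_{1-\alpha}$ are interior-disjoint, unless both are pieces at faces (which lie in $A\cap B$ and do not move); (c) the interior of $\bigcup_P P_\alpha$ and the interior of $\bigcup_Q Q_{1-\alpha}$ intersect exactly in $\operatorname{int}A\cap\operatorname{int}B$; in particular, all pieces of $A$ and all pieces of $B$ are interior-disjoint after scaling if $A$ and $B$ are interior-disjoint. (2) Let $A,B$ be nonempty compact sets in the plane and $\alpha\in[0,1]$. Then the areas satisfy $$|T_\alpha(A,B)|\ \ge\ (1-\alpha)^2|A|+\alpha^2|B|.$$ Equality holds if $A$ and $B$ are disjoint and only finitely many points of $B$ are closest points of points of $A$, and only finitely many points of $A$ are closest points of points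 of $B$. -/

import Mathlib

open MeasureTheory Set

noncomputable section

namespace VoronoiMorph

/-- The Euclidean plane. -/
abbrev Plane : Type := EuclideanSpace ℝ (Fin 2)

/-- `c` is a point of `B` closest to `x`, that is, an admissible value of `c(x, B)`.
There may be several such points. -/
def IsClosest (B : Set Plane) (x c : Plane) : Prop :=
  c ∈ B ∧ ∀ y ∈ B, dist x c ≤ dist x y

/-- The points reached from the points of `A` by moving a fraction `α` of the way towards a closest
point of `B`; where there are several closest points, all of them are used. -/
def moved (α : ℝ) (A B : Set Plane) : Set Plane :=
  {p | ∃ a ∈ A, ∃ c, IsClosest B a c ∧ p = a + α • (c - a)}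

/-- The Voronoi morph `T_α(A, B)`. -/
def morph (α : ℝ) (A B : Set Plane) : Set Plane :=
  moved α A B ∪ moved (1 - α) B A

/-- A polygonal shape: a nonempty compact planar set whose boundary is the disjoint union of
finitely many vertices and finitely many open edges (open segments between two distinct vertices).
Several components, holes, and polygons that touch each other are allowed. -/
structure PolygonalShape where
  carrier : Set Plane
  vertices : Set Plane
  /-- Each edge is given by its two endpoints, in one of the two orders. -/
  edges : Set (Plane × Plane)
  isCompact_carrier : IsCompact carrier
  nonempty_carrier : carrier.Nonempty
  finite_vertices : vertices.Finite
  finite_edges : edges.Finite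
  edge_endpoints : ∀ e ∈ edges, e.1 ∈ vertices ∧ e.2 ∈ vertices ∧ e.1 ≠ e.2
  frontier_eq : frontier carrier = vertices ∪ ⋃ e ∈ edges, openSegment ℝ e.1 e.2
  disjoint_edges : edges.PairwiseDisjoint fun e => openSegment ℝ e.1 e.2
  vertex_notMem_edge : ∀ e ∈ edges, ∀ v ∈ vertices, v ∉ openSegment ℝ e.1 e.2

/-- The possible sites of a Voronoi diagram: vertices, open edges, and faces. -/
inductive Site where
  | vertex (v : Plane) : Site
  | edge (p q : Plane) : Site
  | face (C : Set Plane) : Site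

namespace Site

/-- The set of points that make up the site. -/
def points : Site → Set Plane
  | vertex v => {v}
  | edge p q => openSegment ℝ p q
  | face C => C

/-- The site is a face. -/
def IsFace : Site → Prop
  | vertex _ => False
  | edge _ _ => False
  | face _ => True

/-- Scaling towards a site by `α`: towards a vertex uniformly, towards an edge perpendicularly to
its supporting line, and not at all towards a face. -/
def scale (α : ℝ) : Site → Plane → Plane
  | vertex v, x => x + α • (v - x)
  | edge p q, x =>
      x + α • ((EuclideanGeometry.orthogonalProjection (affineSpan ℝ {p, q}) x : Plane) - x)
  | face _, x => x

end Site

/-- The sites of a polygonal shape: its vertices, its open edges, and the connected components of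
its interior. -/
def PolygonalShape.sites (S : PolygonalShape) : Set Site :=
  {s | (∃ v ∈ S.vertices, s = Site.vertex v) ∨
    (∃ e ∈ S.edges, s = Site.edge e.1 e.2) ∨
    (∃ x ∈ interior S.carrier, s = Site.face (connectedComponentIn (interior S.carrier) x))}

/-- The cell of the site `s` in the Voronoi diagram of `S`: the points that have a closest point of
`S` on `s`. (A point whose closest point is a vertex is in the cell of that vertex, and not in the
cells of the open edges that end there.) -/
def PolygonalShape.cell (S : PolygonalShape) (s : Site) : Set Plane :=
  {x | ∃ c ∈ s.points, IsClosest S.carrier x c}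

/-- The piece of `A` in the Voronoi cell of the site `s` of `B`. -/
def piece (A B : PolygonalShape) (s : Site) : Set Plane :=
  A.carrier ∩ B.cell s

/-- The piece of `A` in the Voronoi cell of the site `s` of `B`, scaled towards `s` by `α`. -/
def scaledPiece (α : ℝ) (A B : PolygonalShape) (s : Site) : Set Plane :=
  s.scale α '' piece A B s

/-- Two planar sets are interior-disjoint. -/
def InteriorDisjoint (X Y : Set Plane) : Prop :=
  interior X ∩ interior Y = ∅

end VoronoiMorph

end

/-! Everything rests on the inequality `IsClosest.sq_dist_add_le`: once `a` has moved a positive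
fraction of the way to a closest point `c` of `B`, no other point of `B` is closest. A moved point
thus remembers its target, so for `α > 0` scaled pieces at different sites do not even meet.

For `0 < α < 1`, a point of both moved sets lies in `A ∩ B` or divides a segment between two
mutually closest points in the ratio given by `α` (`moved_inter_moved_subset`). These exceptional
sets `between α A B` are disjoint for different `α`, so they contribute no interior; this gives (b)
and (c).

For the areas, closest points depend monotonically on the point, so the motion multiplies distances
by at least `1 - α` and areas by at least its square. Uncountably many disjoint sets `between β A B`
cannot all have positive area, and Lipschitz maps between them make all of them null
(`volume_between`); hence the overlap outside `A ∩ B` costs nothing. With finitely many targets, the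
motion consists of finitely many homotheties, and the bound is attained. -/

namespace VoronoiMorph

open Filter Topology RealInnerProductSpace

/-! ### Closest points and the motion towards them -/

/-- On the way from `a` to its closest point `c`, the point `c` stays closest, with a quadratic
gap to the other points. -/
theorem IsClosest.sq_dist_add_le {B : Set Plane} {a c y : Plane} {t : ℝ} (h : IsClosest B a c)
    (hy : y ∈ B) (ht : t ≤ 1) :
    dist (a + t • (c - a)) c ^ 2 + t * dist y c ^ 2 ≤ dist (a + t • (c - a)) y ^ 2 := by
  have h1 : dist a c ^ 2 ≤ dist a y ^ 2 := by
    gcongr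
    exact h.2 y hy
  have e1 : a + t • (c - a) - c = (1 - t) • (a - c) := by module
  have e2 : a + t • (c - a) - y = (1 - t) • (a - c) - (y - c) := by module
  have e3 : a - y = (a - c) - (y - c) := by module
  simp only [dist_eq_norm] at h1 ⊢
  rw [e3, norm_sub_sq_real (a - c)] at h1
  rw [e1, e2, norm_sub_sq_real ((1 - t) • (a - c)), norm_smul, mul_pow, Real.norm_eq_abs, sq_abs,
    real_inner_smul_left]
  nlinarith [mul_le_mul_of_nonneg_left h1 (sub_nonneg.2 ht)]

theorem IsClosest.move {B : Set Plane} {a c : Plane} {t : ℝ} (h : IsClosest B a c)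
    (h0 : 0 ≤ t) (h1 : t ≤ 1) : IsClosest B (a + t • (c - a)) c := by
  refine ⟨h.1, fun y hy => ?_⟩
  have := h.sq_dist_add_le hy h1
  exact abs_le_of_sq_le_sq' (by nlinarith [mul_nonneg h0 (sq_nonneg (dist y c))]) dist_nonneg |>.2

theorem IsClosest.eq_of_move {B : Set Plane} {a c y : Plane} {t : ℝ} (h : IsClosest B a c)
    (h0 : 0 < t) (h1 : t ≤ 1) (hy : IsClosest B (a + t • (c - a)) y) : y = c := by
  have k1 := h.sq_dist_add_le hy.1 h1
  have k2 : dist (a + t • (c - a)) y ^ 2 ≤ dist (a + t • (c - a)) c ^ 2 := by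
    gcongr
    exact hy.2 c h.1
  have k3 : t * dist y c ^ 2 ≤ 0 := by linarith
  have k4 : dist y c ^ 2 ≤ 0 := nonpos_of_mul_nonpos_right k3 h0
  have k5 : dist y c = 0 := by nlinarith [dist_nonneg (x := y) (y := c)]
  exact dist_eq_zero.1 k5

theorem IsClosest.eq_of_mem {B : Set Plane} {a c : Plane} (h : IsClosest B a c) (ha : a ∈ B) :
    c = a := by
  have := h.2 a ha
  rw [dist_self] at this
  exact (dist_le_zero.1 this).symm

theorem isClosest_self {B : Set Plane} {a : Plane} (ha : a ∈ B) : IsClosest B a a :=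
  ⟨ha, fun y _ => by simp⟩

theorem exists_isClosest {B : Set Plane} (hB : IsCompact B) (hne : B.Nonempty) (a : Plane) :
    ∃ c, IsClosest B a c := by
  obtain ⟨c, hc, h⟩ := hB.exists_isMinOn hne (f := fun y => dist a y) (by fun_prop)
  exact ⟨c, hc, fun y hy => h hy⟩

/-- A closest point inside a segment of `B` is the foot of a perpendicular. -/
theorem IsClosest.inner_eq_zero {B : Set Plane} {a c v : Plane} (h : IsClosest B a c)
    (hv : ∀ᶠ t : ℝ in 𝓝 0, c + t • v ∈ B) : ⟪a - c, v⟫ = 0 := by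
  -- The function is `‖a - (c + t • v)‖ ^ 2`, expanded; its local minimum at `t = 0` makes the
  -- derivative vanish.
  have hd : HasDerivAt (fun t : ℝ => ‖a - c‖ ^ 2 - 2 * (t * ⟪a - c, v⟫) + t ^ 2 * ‖v‖ ^ 2)
      (- 2 * ⟪a - c, v⟫) 0 := by
    have := ((((hasDerivAt_id (0 : ℝ)).mul_const ⟪a - c, v⟫).const_mul 2).const_sub
      (‖a - c‖ ^ 2)).add (((hasDerivAt_id (0 : ℝ)).pow 2).mul_const (‖v‖ ^ 2))
    convert! this using 1
    simp
  have hm : IsLocalMin (fun t : ℝ => ‖a - c‖ ^ 2 - 2 * (t * ⟪a - c, v⟫) + t ^ 2 * ‖v‖ ^ 2) 0 := by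
    filter_upwards [hv] with t ht
    have h1 : dist a c ^ 2 ≤ dist a (c + t • v) ^ 2 := by
      gcongr
      exact h.2 _ ht
    have e : a - (c + t • v) = (a - c) - t • v := by module
    rw [dist_eq_norm, dist_eq_norm, e, norm_sub_sq_real (a - c), real_inner_smul_right, norm_smul,
      mul_pow, Real.norm_eq_abs, sq_abs] at h1
    simpa using h1
  have := hm.hasDerivAt_eq_zero hd
  linarith

theorem dist_move_right (a c : Plane) {t : ℝ} (ht : t ≤ 1) :
    dist (a + t • (c - a)) c = (1 - t) * dist a c := by
  rw [dist_eq_norm, dist_eq_norm, show a + t • (c - a) - c = (1 - t) • (a - c) by module,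
    norm_smul, Real.norm_of_nonneg (sub_nonneg.2 ht)]

theorem dist_move_left (a c : Plane) {t : ℝ} (ht : 0 ≤ t) :
    dist (a + t • (c - a)) a = t * dist a c := by
  rw [dist_eq_norm, dist_comm a, dist_eq_norm, show a + t • (c - a) - a = t • (c - a) by module,
    norm_smul, Real.norm_of_nonneg ht]

theorem move_comm (a c : Plane) (t : ℝ) : a + t • (c - a) = c + (1 - t) • (a - c) := by module

/-! ### Points common to both moved sets -/

/-- The points that divide, in the ratio given by `α`, a segment between two distinct points
of `A` and `B` that are closest to each other. -/
def between (α : ℝ) (A B : Set Plane) : Set Plane :=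
  {x | ∃ a c, IsClosest B a c ∧ IsClosest A c a ∧ a ≠ c ∧ x = a + α • (c - a)}

/-- If `x` comes from `a → c` and from `b → d`, comparing its distances to `c`, `b` and to `d`, `a`
forces `dist a c = dist b d`. So `b` and `a` are closest to `x` too, and uniqueness gives `b = c`,
`a = d`. -/
theorem moved_inter_moved_subset {A B : Set Plane} {α : ℝ} (h0 : 0 < α) (h1 : α < 1) :
    moved α A B ∩ moved (1 - α) B A ⊆ A ∩ B ∪ between α A B := by
  rintro x ⟨⟨a, ha, c, hc, rfl⟩, b, hb, d, hd, hx⟩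
  have hxc := hc.move h0.le h1.le
  have hxd := hd.move (sub_nonneg.2 h1.le) (by linarith : 1 - α ≤ 1)
  have e1 := dist_move_right a c h1.le
  have e2 := dist_move_left a c h0.le
  have e3 := dist_move_right b d (by linarith : 1 - α ≤ 1)
  have e4 := dist_move_left b d (sub_nonneg.2 h1.le)
  rw [← hx] at e3 e4 hxd
  have i1 := hxc.2 b hb
  have i2 := hxd.2 a ha
  rw [e1, e4] at i1
  rw [e2, e3] at i2
  have j1 := le_of_mul_le_mul_left i1 (sub_pos.2 h1)
  have j2 : dist b d ≤ dist a c := by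
    rw [sub_sub_cancel] at i2
    exact le_of_mul_le_mul_left i2 h0
  have j := le_antisymm j1 j2
  have hb' : b = c := hc.eq_of_move h0 h1.le
    ⟨hb, fun y hy => by rw [e4, ← j, ← e1]; exact hxc.2 y hy⟩
  have ha' : a = d := by
    refine hd.eq_of_move (sub_pos.2 h1) (by linarith : 1 - α ≤ 1)
      ⟨ha, fun y hy => ?_⟩
    rw [← hx, e2, j]
    have := hxd.2 y hy
    rwa [e3, sub_sub_cancel] at this
  subst hb' ha'
  by_cases hac : a = b
  · subst hac
    left
    simpa using ⟨ha, hb⟩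
  · exact Or.inr ⟨a, b, hc, hd, hac, rfl⟩

/-- By `eq_of_move` from either end, the point determines both endpoints, hence the ratio. -/
theorem disjoint_between {A B : Set Plane} {α β : ℝ} (hα : α ∈ Ioo (0 : ℝ) 1)
    (hβ : β ∈ Ioo (0 : ℝ) 1) (hne : α ≠ β) : Disjoint (between α A B) (between β A B) := by
  rw [Set.disjoint_left]
  rintro x ⟨a, c, hc, ha, hac, rfl⟩ ⟨a', c', hc', ha', hac', hx⟩
  have h1 : c' = c := by
    refine hc.eq_of_move hα.1 hα.2.le ?_
    rw [hx]
    exact hc'.move hβ.1.le hβ.2.le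
  have h2 : a' = a := by
    refine ha.eq_of_move (sub_pos.2 hα.2) (by linarith [hα.1] : 1 - α ≤ 1) ?_
    rw [← move_comm, hx, move_comm]
    exact ha'.move (sub_nonneg.2 hβ.2.le) (by linarith [hβ.1])
  subst h1 h2
  have h3 : (α - β) • (c' - a') = 0 := by
    rw [sub_smul, sub_eq_zero]
    exact add_left_cancel hx
  rcases smul_eq_zero.1 h3 with h | h
  · exact hne (sub_eq_zero.1 h)
  · exact hac (sub_eq_zero.1 h).symm

theorem disjoint_between_right {A B : Set Plane} {α : ℝ} (h0 : 0 ≤ α) (h1 : α < 1) :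
    Disjoint (between α A B) B := by
  rw [Set.disjoint_left]
  rintro x ⟨a, c, hc, ha, hac, rfl⟩ hB
  have := (hc.move h0 h1.le).eq_of_mem hB
  have h3 : (1 - α) • (c - a) = 0 := by
    rw [sub_smul, one_smul, sub_eq_zero, ← sub_eq_iff_eq_add'.2 this]
  rcases smul_eq_zero.1 h3 with h | h
  · linarith
  · exact hac (sub_eq_zero.1 h).symm

theorem moved_zero_subset (A B : Set Plane) : moved 0 A B ⊆ A := by
  rintro x ⟨a, ha, c, hc, rfl⟩
  simpa using ha

theorem inter_subset_moved (α : ℝ) (A B : Set Plane) : A ∩ B ⊆ moved α A B :=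
  fun x hx => ⟨x, hx.1, x, isClosest_self hx.2, by simp⟩

/-- Near an interior point every direction is allowed in `inner_eq_zero`, in particular `a - c`. -/
theorem IsClosest.eq_of_mem_interior {B : Set Plane} {a c : Plane} (h : IsClosest B a c)
    (hc : c ∈ interior B) : c = a := by
  have hv : ∀ᶠ t : ℝ in 𝓝 0, c + t • (a - c) ∈ B := by
    have hcont : ContinuousAt (fun t : ℝ => c + t • (a - c)) 0 := by fun_prop
    refine hcont.eventually_mem ?_
    simpa using mem_interior_iff_mem_nhds.1 hc
  have := h.inner_eq_zero hv
  exact (sub_eq_zero.1 (inner_self_eq_zero.1 this)).symm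

theorem interior_moved_zero_inter_subset (A B : Set Plane) :
    interior (moved 0 A B) ∩ moved 1 B A ⊆ A ∩ B := by
  rintro x ⟨hx, b, hb, d, hd, rfl⟩
  have hx' := interior_mono (moved_zero_subset A B) hx
  rw [one_smul, add_sub_cancel] at hx' ⊢
  have := hd.eq_of_mem_interior hx'
  exact ⟨hd.1, this ▸ hb⟩

theorem interior_moved_inter_subset {A B : Set Plane} {α : ℝ} (h0 : 0 ≤ α) (h1 : α ≤ 1) :
    interior (moved α A B) ∩ interior (moved (1 - α) B A) ⊆ A ∩ B := by
  rcases h0.eq_or_lt with rfl | h0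
  · rw [sub_zero]
    exact (inter_subset_inter_right _ interior_subset).trans (interior_moved_zero_inter_subset A B)
  rcases h1.eq_or_lt with rfl | h1
  · rw [sub_self, inter_comm, inter_comm A]
    exact (inter_subset_inter_right _ interior_subset).trans (interior_moved_zero_inter_subset B A)
  intro x hx
  rcases moved_inter_moved_subset h0 h1 ⟨interior_subset hx.1, interior_subset hx.2⟩ with h | h
  · exact h
  exfalso
  obtain ⟨a, c, hc, ha, hac, rfl⟩ := h
  -- Near `x` the segment stays in both moved sets. Its point with a ratio `t > α` would then lie in
  -- `B` or in `between α A B`, but it lies in `between t A B`, which is disjoint from both.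
  have hcont : ContinuousAt (fun t : ℝ => a + t • (c - a)) α := by fun_prop
  have hU : ∀ᶠ t : ℝ in 𝓝 α, a + t • (c - a) ∈
      interior (moved α A B) ∩ interior (moved (1 - α) B A) :=
    hcont.eventually_mem ((isOpen_interior.inter isOpen_interior).mem_nhds hx)
  have hE := ((hU.and (Ioo_mem_nhds h0 h1)).filter_mono
    (nhdsWithin_le_nhds (s := Ioi α))).and self_mem_nhdsWithin
  obtain ⟨t, ⟨htU, ht⟩, hta⟩ := hE.exists
  have hbt : a + t • (c - a) ∈ between t A B := ⟨a, c, hc, ha, hac, rfl⟩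
  rcases moved_inter_moved_subset h0 h1
    ⟨interior_subset htU.1, interior_subset htU.2⟩ with h | h
  · exact (disjoint_between_right ht.1.le ht.2).le_bot ⟨hbt, h.2⟩
  · exact (disjoint_between ⟨h0, h1⟩ ht (ne_of_lt hta)).le_bot ⟨h, hbt⟩

theorem interior_moved_inter_eq {A B : Set Plane} {α : ℝ} (h0 : 0 ≤ α) (h1 : α ≤ 1) :
    interior (moved α A B) ∩ interior (moved (1 - α) B A) = interior A ∩ interior B := by
  apply Subset.antisymm
  · rw [← interior_inter (s := A)]
    exact interior_maximal (interior_moved_inter_subset h0 h1)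
      (isOpen_interior.inter isOpen_interior)
  · rw [← interior_inter]
    refine subset_inter (interior_mono (inter_subset_moved _ _ _)) (interior_mono ?_)
    rw [inter_comm]
    exact inter_subset_moved _ _ _

/-! ### Sites and pieces of polygonal shapes -/

namespace PolygonalShape

variable (S : PolygonalShape)

theorem isClosed_carrier : IsClosed S.carrier := S.isCompact_carrier.isClosed

theorem frontier_subset_carrier : frontier S.carrier ⊆ S.carrier :=
  S.isClosed_carrier.frontier_subset

theorem vertex_mem_frontier {v : Plane} (hv : v ∈ S.vertices) : v ∈ frontier S.carrier := by
  rw [S.frontier_eq]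
  exact Or.inl hv

theorem edge_subset_frontier {e : Plane × Plane} (he : e ∈ S.edges) :
    openSegment ℝ e.1 e.2 ⊆ frontier S.carrier := by
  rw [S.frontier_eq]
  exact fun x hx => Or.inr (mem_biUnion he hx)

theorem points_subset_of_mem_sites {s : Site} (hs : s ∈ S.sites) :
    s.points ⊆ frontier S.carrier ∧ ¬ s.IsFace ∨ s.points ⊆ interior S.carrier ∧ s.IsFace := by
  rcases hs with ⟨v, hv, rfl⟩ | ⟨e, he, rfl⟩ | ⟨x, hx, rfl⟩
  · exact Or.inl ⟨singleton_subset_iff.2 (S.vertex_mem_frontier hv), id⟩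
  · exact Or.inl ⟨S.edge_subset_frontier he, id⟩
  · exact Or.inr ⟨connectedComponentIn_subset _ _, trivial⟩

theorem isFace_of_mem_interior {s : Site} (hs : s ∈ S.sites) {x : Plane} (hx : x ∈ s.points)
    (hi : x ∈ interior S.carrier) : s.IsFace := by
  rcases S.points_subset_of_mem_sites hs with h | h
  · exact absurd hi (h.1 hx).2
  · exact h.2

theorem exists_site {x : Plane} (hx : x ∈ S.carrier) : ∃ s ∈ S.sites, x ∈ s.points := by
  by_cases hi : x ∈ interior S.carrier
  · exact ⟨_, Or.inr (Or.inr ⟨x, hi, rfl⟩), mem_connectedComponentIn hi⟩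
  · have hf : x ∈ frontier S.carrier := ⟨subset_closure hx, hi⟩
    rw [S.frontier_eq] at hf
    rcases hf with hv | he
    · exact ⟨_, Or.inl ⟨x, hv, rfl⟩, rfl⟩
    · obtain ⟨e, he, hxe⟩ := mem_iUnion₂.1 he
      exact ⟨_, Or.inr (Or.inl ⟨e, he, rfl⟩), hxe⟩

/-- Distinct sites have no common points. -/
theorem site_eq_of_mem {s s' : Site} (hs : s ∈ S.sites) (hs' : s' ∈ S.sites) {x : Plane}
    (hx : x ∈ s.points) (hx' : x ∈ s'.points) : s = s' := by
  have key : s.IsFace ↔ s'.IsFace := by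
    rcases S.points_subset_of_mem_sites hs with h | h <;>
      rcases S.points_subset_of_mem_sites hs' with h' | h'
    · exact iff_of_false h.2 h'.2
    · exact absurd (h'.1 hx') (h.1 hx).2
    · exact absurd (h.1 hx) (h'.1 hx').2
    · exact iff_of_true h.2 h'.2
  rcases hs with ⟨v, hv, rfl⟩ | ⟨e, he, rfl⟩ | ⟨y, hy, rfl⟩ <;>
    rcases hs' with ⟨v', hv', rfl⟩ | ⟨e', he', rfl⟩ | ⟨y', hy', rfl⟩ <;>
    simp only [Site.IsFace, Site.points, iff_true, iff_false, not_true, mem_singleton_iff]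
      at key hx hx'
  · rw [← hx, ← hx']
  · exact absurd hx' (S.vertex_notMem_edge e' he' x (hx ▸ hv))
  · exact absurd hx (S.vertex_notMem_edge e he x (hx' ▸ hv'))
  · by_cases h : e = e'
    · rw [h]
    · exact absurd hx' (Set.disjoint_left.1 (S.disjoint_edges he he' h) hx)
  · rw [connectedComponentIn_eq hx, connectedComponentIn_eq hx']

end PolygonalShape

/-- An open edge lets `c` vary both ways along it within `B`, so `a - c` is perpendicular to it. -/
theorem orthogonalProjection_eq_of_isClosest {B : Set Plane} {p q a c : Plane}
    (hpq : openSegment ℝ p q ⊆ B) (hc : c ∈ openSegment ℝ p q) (h : IsClosest B a c) :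
    (EuclideanGeometry.orthogonalProjection (affineSpan ℝ {p, q}) a : Plane) = c := by
  rw [EuclideanGeometry.coe_orthogonalProjection_eq_iff_mem]
  rw [openSegment_eq_image'] at hpq hc
  obtain ⟨θ, hθ, rfl⟩ := hc
  constructor
  · have := AffineMap.lineMap_mem_affineSpan_pair (k := ℝ) θ p q
    rwa [AffineMap.lineMap_apply_module', add_comm] at this
  · rw [direction_affineSpan, vectorSpan_pair_rev, Submodule.mem_orthogonal_singleton_iff_inner_left]
    have hv : ∀ᶠ t : ℝ in 𝓝 0, p + θ • (q - p) + t • (q - p) ∈ B := by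
      have hcont : ContinuousAt (fun t : ℝ => θ + t) 0 := by fun_prop
      filter_upwards [hcont.eventually_mem (s := Ioo 0 1)
        (by simpa using Ioo_mem_nhds hθ.1 hθ.2)] with t ht
      exact hpq ⟨θ + t, ht, by module⟩
    exact h.inner_eq_zero hv

/-- Scaling towards a site moves every point of the cell of the site towards its closest point. -/
theorem scaledPiece_eq (α : ℝ) (A B : PolygonalShape) {s : Site} (hs : s ∈ B.sites) :
    scaledPiece α A B s =
      {x | ∃ a ∈ A.carrier, ∃ c ∈ s.points, IsClosest B.carrier a c ∧ x = a + α • (c - a)} := by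
  have key : ∀ a c, c ∈ s.points → IsClosest B.carrier a c → s.scale α a = a + α • (c - a) := by
    intro a c hc h
    rcases hs with ⟨v, hv, rfl⟩ | ⟨e, he, rfl⟩ | ⟨y, hy, rfl⟩
    · rw [show c = v from hc]
      rfl
    · simp only [Site.scale]
      rw [orthogonalProjection_eq_of_isClosest
        ((B.edge_subset_frontier he).trans B.frontier_subset_carrier) hc h]
    · have := h.eq_of_mem_interior (connectedComponentIn_subset _ _ hc)
      simp [Site.scale, this]
  ext x
  constructor
  · rintro ⟨a, ⟨ha, c, hc, h⟩, rfl⟩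
    exact ⟨a, ha, c, hc, h, key a c hc h⟩
  · rintro ⟨a, ha, c, hc, h, rfl⟩
    exact ⟨a, ⟨ha, c, hc, h⟩, key a c hc h⟩

theorem iUnion_piece (A B : PolygonalShape) : (⋃ s ∈ B.sites, piece A B s) = A.carrier := by
  apply Subset.antisymm
  · exact iUnion₂_subset fun s _ => inter_subset_left
  · intro a ha
    obtain ⟨c, hc⟩ := exists_isClosest B.isCompact_carrier B.nonempty_carrier a
    obtain ⟨s, hs, hcs⟩ := B.exists_site hc.1
    exact mem_biUnion hs ⟨ha, c, hcs, hc⟩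

theorem iUnion_scaledPiece (α : ℝ) (A B : PolygonalShape) :
    (⋃ s ∈ B.sites, scaledPiece α A B s) = moved α A.carrier B.carrier := by
  ext x
  rw [mem_iUnion₂]
  constructor
  · rintro ⟨s, hs, hx⟩
    rw [scaledPiece_eq α A B hs] at hx
    obtain ⟨a, ha, c, -, h, rfl⟩ := hx
    exact ⟨a, ha, c, h, rfl⟩
  · rintro ⟨a, ha, c, h, rfl⟩
    obtain ⟨s, hs, hcs⟩ := B.exists_site h.1
    refine ⟨s, hs, ?_⟩
    rw [scaledPiece_eq α A B hs]
    exact ⟨a, ha, c, hcs, h, rfl⟩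

theorem scaledPiece_subset_moved (α : ℝ) (A B : PolygonalShape) {s : Site} (hs : s ∈ B.sites) :
    scaledPiece α A B s ⊆ moved α A.carrier B.carrier := by
  rw [← iUnion_scaledPiece]
  exact subset_biUnion_of_mem (u := fun s => scaledPiece α A B s) hs

theorem mem_points_of_mem_scaledPiece {α : ℝ} (h0 : 0 ≤ α) (h1 : α ≤ 1) {A B : PolygonalShape}
    {s : Site} (hs : s ∈ B.sites) {x : Plane} (hx : x ∈ scaledPiece α A B s)
    (hB : x ∈ B.carrier) : x ∈ s.points := by
  rw [scaledPiece_eq α A B hs] at hx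
  obtain ⟨a, ha, c, hcs, h, rfl⟩ := hx
  rwa [← (h.move h0 h1).eq_of_mem hB]

theorem interiorDisjoint_scaledPiece {α : ℝ} (h0 : 0 ≤ α) (h1 : α ≤ 1) (A B : PolygonalShape)
    {s s' : Site} (hs : s ∈ B.sites) (hs' : s' ∈ B.sites) (hne : s ≠ s') :
    InteriorDisjoint (scaledPiece α A B s) (scaledPiece α A B s') := by
  rw [InteriorDisjoint, eq_empty_iff_forall_notMem]
  intro x hx
  apply hne
  rcases h0.eq_or_lt with rfl | h0
  -- Unmoved points may have several closest points. Pushing `x` slightly towards `c` keeps it in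
  -- the other piece and makes `c` its only closest point.
  · have hsub : ∀ {t : Site}, t ∈ B.sites → scaledPiece 0 A B t ⊆ B.cell t := by
      intro t ht y hy
      rw [scaledPiece_eq 0 A B ht] at hy
      obtain ⟨a, -, c, hc, h, rfl⟩ := hy
      exact ⟨c, hc, by simpa using h⟩
    obtain ⟨c, hc, h⟩ := hsub hs (interior_subset hx.1)
    have hcont : ContinuousAt (fun t : ℝ => x + t • (c - x)) 0 := by fun_prop
    have hU : ∀ᶠ t : ℝ in 𝓝 0, x + t • (c - x) ∈ interior (scaledPiece 0 A B s') :=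
      hcont.eventually_mem (isOpen_interior.mem_nhds (by simpa using hx.2))
    have hE := ((hU.and (Iio_mem_nhds one_pos)).filter_mono
      (nhdsWithin_le_nhds (s := Ioi 0))).and self_mem_nhdsWithin
    obtain ⟨t, ⟨htU, ht1⟩, ht0⟩ := hE.exists
    obtain ⟨c', hc', h'⟩ := hsub hs' (interior_subset htU)
    rw [h.eq_of_move ht0 (le_of_lt ht1) h'] at hc'
    exact B.site_eq_of_mem hs hs' hc hc'
  · have hx1 := interior_subset hx.1
    have hx2 := interior_subset hx.2
    rw [scaledPiece_eq α A B hs] at hx1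
    rw [scaledPiece_eq α A B hs'] at hx2
    obtain ⟨a, -, c, hc, h, rfl⟩ := hx1
    obtain ⟨a', -, c', hc', h', hx⟩ := hx2
    have : c' = c := h.eq_of_move h0 h1 (hx ▸ h'.move h0.le h1)
    exact B.site_eq_of_mem hs hs' hc (this ▸ hc')

theorem interiorDisjoint_scaledPiece_scaledPiece {α : ℝ} (h0 : 0 ≤ α) (h1 : α ≤ 1)
    (A B : PolygonalShape) {s t : Site} (hs : s ∈ B.sites) (ht : t ∈ A.sites)
    (hst : ¬ (s.IsFace ∧ t.IsFace)) :
    InteriorDisjoint (scaledPiece α A B s) (scaledPiece (1 - α) B A t) := by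
  rw [InteriorDisjoint, eq_empty_iff_forall_notMem]
  intro x hx
  apply hst
  have hi : x ∈ interior A.carrier ∩ interior B.carrier := by
    rw [← interior_moved_inter_eq h0 h1]
    exact ⟨interior_mono (scaledPiece_subset_moved α A B hs) hx.1,
      interior_mono (scaledPiece_subset_moved (1 - α) B A ht) hx.2⟩
  exact ⟨B.isFace_of_mem_interior hs (mem_points_of_mem_scaledPiece h0 h1 hs
      (interior_subset hx.1) (interior_subset hi.2)) hi.2,
    A.isFace_of_mem_interior ht (mem_points_of_mem_scaledPiece (sub_nonneg.2 h1)
      (by linarith) ht (interior_subset hx.2) (interior_subset hi.1)) hi.1⟩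

/-! ### Areas -/

/-- If distances between values of `f` are at least `k` times the distances between the values
of `g`, then the areas of the images compare with the factor `k ^ 2`. -/
theorem volume_image_le_of_expanding {ι : Type*} (f g : ι → Plane) (S : Set ι) {k : ℝ}
    (hk : 0 < k) (h : ∀ i ∈ S, ∀ j ∈ S, k * dist (g i) (g j) ≤ dist (f i) (f j)) :
    ENNReal.ofReal (k ^ 2) * volume (g '' S) ≤ volume (f '' S) := by
  classical
  -- `r` sends `f i` to `g i`; the choice of `i` is harmless because equal values of `f` force equal
  -- values of `g`.
  let r : Plane → Plane := fun x => if hx : x ∈ f '' S then g hx.choose else 0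
  have hr : ∀ i ∈ S, r (f i) = g i := by
    intro i hi
    have hx : f i ∈ f '' S := mem_image_of_mem f hi
    have h1 : r (f i) = g hx.choose := dif_pos hx
    have h2 := h _ hx.choose_spec.1 _ hi
    rw [hx.choose_spec.2, dist_self] at h2
    rw [h1]
    exact dist_le_zero.1 (nonpos_of_mul_nonpos_right h2 hk)
  have hL : LipschitzOnWith (Real.toNNReal k⁻¹) r (f '' S) := by
    refine LipschitzOnWith.of_dist_le_mul ?_
    rintro _ ⟨i, hi, rfl⟩ _ ⟨j, hj, rfl⟩
    rw [hr i hi, hr j hj, Real.coe_toNNReal _ (inv_nonneg.2 hk.le), ← div_eq_inv_mul,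
      le_div_iff₀' hk]
    exact h i hi j hj
  have himg : r '' (f '' S) = g '' S := by
    rw [image_image]
    exact image_congr hr
  -- Area is a constant multiple of the 2-dimensional Hausdorff measure, which a Lipschitz map
  -- controls on arbitrary sets.
  have hH := hL.hausdorffMeasure_image_le (d := 2) (by norm_num)
  rw [himg] at hH
  have hfin : Module.finrank ℝ Plane = 2 := by simp
  have : (Measure.hausdorffMeasure 2 : Measure Plane).IsAddHaarMeasure := by
    have := isAddHaarMeasure_hausdorffMeasure (E := Plane)
    rw [hfin] at this
    exact_mod_cast this
  have hμ := Measure.isAddLeftInvariant_eq_smul (volume : Measure Plane)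
    (Measure.hausdorffMeasure 2)
  rw [hμ]
  simp only [Measure.smul_apply, ENNReal.smul_def, smul_eq_mul]
  rw [mul_left_comm]
  gcongr
  calc ENNReal.ofReal (k ^ 2) * Measure.hausdorffMeasure 2 (g '' S)
      ≤ ENNReal.ofReal (k ^ 2) * (((Real.toNNReal k⁻¹ : NNReal) : ENNReal) ^ (2 : ℝ) *
        Measure.hausdorffMeasure 2 (f '' S)) := by gcongr
    _ = Measure.hausdorffMeasure 2 (f '' S) := by
      rw [← mul_assoc]
      have : ENNReal.ofReal (k ^ 2) * ((Real.toNNReal k⁻¹ : NNReal) : ENNReal) ^ (2 : ℝ) = 1 := by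
        change _ * ENNReal.ofReal k⁻¹ ^ (2 : ℝ) = 1
        rw [ENNReal.rpow_ofNat, ← ENNReal.ofReal_pow (inv_nonneg.2 hk.le),
          ← ENNReal.ofReal_mul (by positivity), ← mul_pow, mul_inv_cancel₀ hk.ne']
        simp
      rw [this, one_mul]

/-! ### Monotonicity and distance estimates -/

/-- Closest points depend monotonically on the point. -/
theorem IsClosest.inner_nonneg {B : Set Plane} {a c a' c' : Plane} (h : IsClosest B a c)
    (h' : IsClosest B a' c') : 0 ≤ ⟪a - a', c - c'⟫ := by
  have h1 : dist a c ^ 2 ≤ dist a c' ^ 2 := by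
    gcongr
    exact h.2 _ h'.1
  have h2 : dist a' c' ^ 2 ≤ dist a' c ^ 2 := by
    gcongr
    exact h'.2 _ h.1
  rw [dist_eq_norm, dist_eq_norm, norm_sub_sq_real, norm_sub_sq_real] at h1 h2
  rw [inner_sub_left, inner_sub_right, inner_sub_right]
  linarith

theorem norm_sq_combination (u w : Plane) (t : ℝ) : ‖(1 - t) • u + t • w‖ ^ 2 =
    (1 - t) ^ 2 * ‖u‖ ^ 2 + 2 * (t * (1 - t)) * ⟪u, w⟫ + t ^ 2 * ‖w‖ ^ 2 := by
  rw [norm_add_sq_real, norm_smul, norm_smul, real_inner_smul_left, real_inner_smul_right,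
    mul_pow, mul_pow, Real.norm_eq_abs, Real.norm_eq_abs, sq_abs, sq_abs]
  ring

theorem move_sub_move (a c a' c' : Plane) (t : ℝ) :
    (a + t • (c - a)) - (a' + t • (c' - a')) = (1 - t) • (a - a') + t • (c - c') := by module

theorem IsClosest.mul_dist_le_dist_move {B : Set Plane} {a c a' c' : Plane} {t : ℝ}
    (h : IsClosest B a c) (h' : IsClosest B a' c') (h0 : 0 ≤ t) (h1 : t ≤ 1) :
    (1 - t) * dist a a' ≤ dist (a + t • (c - a)) (a' + t • (c' - a')) := by
  have h2 := h.inner_nonneg h'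
  rw [dist_eq_norm, dist_eq_norm, move_sub_move]
  refine abs_le_of_sq_le_sq' ?_ (norm_nonneg _) |>.2
  rw [norm_sq_combination]
  have := mul_nonneg (mul_nonneg h0 (sub_nonneg.2 h1)) h2
  have := mul_nonneg (sq_nonneg t) (sq_nonneg ‖c - c'‖)
  linarith [mul_pow (1 - t) ‖a - a'‖ 2]

/-- Both squared distances are combinations of the same three nonnegative quantities, so
coefficients can be compared one by one. This makes passing from ratio `t` to ratio `s` Lipschitz
when `0 < t < 1`. -/
theorem IsClosest.min_mul_dist_move_le {B : Set Plane} {a c a' c' : Plane} {s t : ℝ}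
    (h : IsClosest B a c) (h' : IsClosest B a' c') (hs : s ∈ Icc (0 : ℝ) 1)
    (ht : t ∈ Icc (0 : ℝ) 1) :
    min t (1 - t) * dist (a + s • (c - a)) (a' + s • (c' - a')) ≤
      dist (a + t • (c - a)) (a' + t • (c' - a')) := by
  have h2 := h.inner_nonneg h'
  rw [dist_eq_norm, dist_eq_norm, move_sub_move, move_sub_move]
  refine abs_le_of_sq_le_sq' ?_ (norm_nonneg _) |>.2
  rw [mul_pow, norm_sq_combination, norm_sq_combination]
  set k := min t (1 - t)
  have hk0 : 0 ≤ k := le_min ht.1 (sub_nonneg.2 ht.2)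
  have hk1 : k ≤ t := min_le_left _ _
  have hk2 : k ≤ 1 - t := min_le_right _ _
  have i1 : k ^ 2 * (1 - s) ^ 2 ≤ (1 - t) ^ 2 := by
    rw [← mul_pow]
    exact pow_le_pow_left₀ (mul_nonneg hk0 (sub_nonneg.2 hs.2)) (by nlinarith [hs.1]) 2
  have i2 : k ^ 2 * s ^ 2 ≤ t ^ 2 := by
    rw [← mul_pow]
    exact pow_le_pow_left₀ (mul_nonneg hk0 hs.1) (by nlinarith [hs.2]) 2
  have i3 : k ^ 2 * (s * (1 - s)) ≤ t * (1 - t) := by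
    calc k ^ 2 * (s * (1 - s)) ≤ k ^ 2 * 1 := by
          gcongr
          nlinarith [hs.1, hs.2]
      _ = k * k := by ring
      _ ≤ t * (1 - t) := mul_le_mul hk1 hk2 hk0 ht.1
  have j1 := mul_le_mul_of_nonneg_right i1 (sq_nonneg ‖a - a'‖)
  have j2 := mul_le_mul_of_nonneg_right i2 (sq_nonneg ‖c - c'‖)
  have j3 := mul_le_mul_of_nonneg_right i3 h2
  linarith

/-! ### Compactness and the null overlap -/

theorem isClosed_setOf_isClosest {B : Set Plane} (hB : IsClosed B) :
    IsClosed {p : Plane × Plane | IsClosest B p.1 p.2} := by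
  have : {p : Plane × Plane | IsClosest B p.1 p.2} =
      {p | p.2 ∈ B} ∩ ⋂ y ∈ B, {p | dist p.1 p.2 ≤ dist p.1 y} := by
    ext p
    simp [IsClosest]
  rw [this]
  exact (hB.preimage continuous_snd).inter
    (isClosed_biInter fun y _ => isClosed_le (by fun_prop) (by fun_prop))

theorem isCompact_moved {A B : Set Plane} (hA : IsCompact A) (hB : IsCompact B) (α : ℝ) :
    IsCompact (moved α A B) := by
  have h : IsCompact ((A ×ˢ B) ∩ {p : Plane × Plane | IsClosest B p.1 p.2}) :=
    (hA.prod hB).inter_right (isClosed_setOf_isClosest hB.isClosed)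
  convert h.image (f := fun p : Plane × Plane => p.1 + α • (p.2 - p.1)) (by fun_prop) using 1
  ext x
  constructor
  · rintro ⟨a, ha, c, hc, rfl⟩
    exact ⟨(a, c), ⟨⟨ha, hc.1⟩, hc⟩, rfl⟩
  · rintro ⟨⟨a, c⟩, ⟨⟨ha, -⟩, hc⟩, rfl⟩
    exact ⟨a, ha, c, hc, rfl⟩

/-- Writes the set in terms of compact sets, for measurability. -/
theorem between_eq_diff {A B : Set Plane} {α : ℝ} (hα : α ∈ Ioo (0 : ℝ) 1) :
    between α A B = (moved α A B ∩ moved (1 - α) B A) \ (A ∩ B) := by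
  apply Subset.antisymm
  · intro x hx
    refine ⟨?_, fun h => (disjoint_between_right hα.1.le hα.2).le_bot ⟨hx, h.2⟩⟩
    obtain ⟨a, c, hc, ha, -, rfl⟩ := hx
    exact ⟨⟨a, ha.1, c, hc, rfl⟩, c, hc.1, a, ha, move_comm a c α⟩
  · rintro x ⟨hx, hn⟩
    exact (moved_inter_moved_subset hα.1 hα.2 hx).resolve_left hn

theorem volume_between {A B : Set Plane} (hA : IsCompact A) (hB : IsCompact B) {α : ℝ}
    (hα : α ∈ Ioo (0 : ℝ) 1) : volume (between α A B) = 0 := by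
  have hm : ∀ β : Ioo (0 : ℝ) 1, MeasurableSet (between β A B) := by
    intro β
    rw [between_eq_diff β.2]
    exact ((isCompact_moved hA hB _).measurableSet.inter
      (isCompact_moved hB hA _).measurableSet).diff (hA.measurableSet.inter hB.measurableSet)
  have hcount := Measure.countable_meas_pos_of_disjoint_iUnion (μ := (volume : Measure Plane)) hm
    fun β γ hne => disjoint_between β.2 γ.2 (Subtype.coe_injective.ne hne)
  -- Only countably many disjoint sets can have positive area, but the interval of ratios is
  -- uncountable.
  obtain ⟨β, hβ⟩ : ∃ β : Ioo (0 : ℝ) 1, volume (between β A B) = 0 := by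
    by_contra! hall
    have hu : {β : Ioo (0 : ℝ) 1 | 0 < volume (between β A B)} = univ :=
      eq_univ_of_forall fun β => pos_iff_ne_zero.2 (hall β)
    rw [hu, countable_univ_iff, countable_coe_iff] at hcount
    have := hcount.measure_zero volume
    simp at this
  have himg : ∀ t : ℝ, between t A B = (fun p : Plane × Plane => p.1 + t • (p.2 - p.1)) ''
      {p | IsClosest B p.1 p.2 ∧ IsClosest A p.2 p.1 ∧ p.1 ≠ p.2} := by
    intro t
    ext x
    constructor
    · rintro ⟨a, c, hc, ha, hac, rfl⟩
      exact ⟨(a, c), ⟨hc, ha, hac⟩, rfl⟩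
    · rintro ⟨⟨a, c⟩, ⟨hc, ha, hac⟩, rfl⟩
      exact ⟨a, c, hc, ha, hac, rfl⟩
  have hk : 0 < min (β : ℝ) (1 - β) := lt_min β.2.1 (sub_pos.2 β.2.2)
  have hle := volume_image_le_of_expanding
    (fun p : Plane × Plane => p.1 + (β : ℝ) • (p.2 - p.1))
    (fun p : Plane × Plane => p.1 + α • (p.2 - p.1))
    {p | IsClosest B p.1 p.2 ∧ IsClosest A p.2 p.1 ∧ p.1 ≠ p.2} hk
    fun p hp q hq => hp.1.min_mul_dist_move_le hq.1 (Ioo_subset_Icc_self hα)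
      (Ioo_subset_Icc_self β.2)
  rw [← himg, ← himg, hβ, nonpos_iff_eq_zero, mul_eq_zero] at hle
  refine hle.resolve_left ?_
  rw [ENNReal.ofReal_eq_zero, not_le]
  positivity

/-! ### The lower bound on the area -/

theorem volume_diff_le_volume_moved_diff {A B : Set Plane} (hB : IsCompact B) (hne : B.Nonempty)
    {α : ℝ} (h0 : 0 ≤ α) (h1 : α < 1) :
    ENNReal.ofReal ((1 - α) ^ 2) * volume (A \ B) ≤ volume (moved α A B \ B) := by
  -- Indexing by pairs avoids selecting a closest point for each `a`.
  have h := volume_image_le_of_expanding (fun p : Plane × Plane => p.1 + α • (p.2 - p.1))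
    Prod.fst {p | p.1 ∈ A \ B ∧ IsClosest B p.1 p.2} (sub_pos.2 h1)
    fun p hp q hq => hp.2.mul_dist_le_dist_move hq.2 h0 h1.le
  have hfst : Prod.fst '' {p : Plane × Plane | p.1 ∈ A \ B ∧ IsClosest B p.1 p.2} = A \ B := by
    ext a
    constructor
    · rintro ⟨p, hp, rfl⟩
      exact hp.1
    · intro ha
      obtain ⟨c, hc⟩ := exists_isClosest hB hne a
      exact ⟨(a, c), ⟨ha, hc⟩, rfl⟩
  rw [hfst] at h
  refine h.trans (measure_mono ?_)
  rintro _ ⟨⟨a, c⟩, ⟨ha, hc⟩, rfl⟩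
  refine ⟨⟨a, ha.1, c, hc, rfl⟩, fun hx => ha.2 ?_⟩
  have h2 := (hc.move h0 h1.le).eq_of_mem hx
  have h3 := dist_move_right a c h1.le
  rw [← h2, dist_self, eq_comm, mul_eq_zero] at h3
  rcases h3 with h3 | h3
  · linarith
  · rw [dist_eq_zero.1 h3]
    exact hc.1

theorem subset_moved_zero (A : Set Plane) {B : Set Plane} (hB : IsCompact B) (hne : B.Nonempty) :
    A ⊆ moved 0 A B := by
  intro a ha
  obtain ⟨c, hc⟩ := exists_isClosest hB hne a
  exact ⟨a, ha, c, hc, by simp⟩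

theorem le_volume_morph {A B : Set Plane} (hA : IsCompact A) (hB : IsCompact B)
    (hAne : A.Nonempty) (hBne : B.Nonempty) {α : ℝ} (h0 : 0 ≤ α) (h1 : α ≤ 1) :
    ENNReal.ofReal ((1 - α) ^ 2) * volume A + ENNReal.ofReal (α ^ 2) * volume B ≤
      volume (morph α A B) := by
  rcases h0.eq_or_lt with rfl | h0
  · simpa using measure_mono (μ := volume) (show A ⊆ morph 0 A B from
      (subset_moved_zero A hB hBne).trans subset_union_left)
  rcases h1.eq_or_lt with rfl | h1
  · simp only [morph, sub_self]
    simpa using measure_mono ((subset_moved_zero B hA hAne).trans subset_union_right)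
  have hX := volume_diff_le_volume_moved_diff (A := A) hB hBne h0.le h1
  have hY := volume_diff_le_volume_moved_diff (A := B) hA hAne (sub_nonneg.2 h1.le)
    (by linarith : 1 - α < 1)
  rw [sub_sub_cancel] at hY
  have hXm := (isCompact_moved hA hB α).measurableSet.diff hB.measurableSet
  have hYm := (isCompact_moved hB hA (1 - α)).measurableSet.diff hA.measurableSet
  have hW := hA.measurableSet.inter hB.measurableSet
  have hXY : AEDisjoint volume (moved α A B \ B) (moved (1 - α) B A \ A) := by
    refine measure_mono_null ?_ (volume_between hA hB ⟨h0, h1⟩)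
    rintro x ⟨hx, hy⟩
    rw [between_eq_diff ⟨h0, h1⟩]
    exact ⟨⟨hx.1, hy.1⟩, fun h => hx.2 h.2⟩
  have hdis : Disjoint ((moved α A B \ B) ∪ (moved (1 - α) B A \ A)) (A ∩ B) := by
    rw [Set.disjoint_left]
    rintro x (hx | hx) hx'
    · exact hx.2 hx'.2
    · exact hx.2 hx'.1
  have hsub : (moved α A B \ B) ∪ (moved (1 - α) B A \ A) ∪ A ∩ B ⊆ morph α A B := by
    refine union_subset (union_subset_union sdiff_subset sdiff_subset) ?_
    exact (inter_subset_moved α A B).trans subset_union_left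
  -- `A ∩ B` stays fixed and counts once in the morph; its total weight on the left is at most 1.
  have hcoef : ENNReal.ofReal ((1 - α) ^ 2) + ENNReal.ofReal (α ^ 2) ≤ 1 := by
    rw [← ENNReal.ofReal_add (by positivity) (by positivity), ENNReal.ofReal_le_one]
    nlinarith
  calc ENNReal.ofReal ((1 - α) ^ 2) * volume A + ENNReal.ofReal (α ^ 2) * volume B
      = ENNReal.ofReal ((1 - α) ^ 2) * volume (A \ B) + ENNReal.ofReal (α ^ 2) * volume (B \ A) +
        (ENNReal.ofReal ((1 - α) ^ 2) + ENNReal.ofReal (α ^ 2)) * volume (A ∩ B) := by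
        rw [← measure_sdiff_add_inter A hB.measurableSet, ← measure_sdiff_add_inter B hA.measurableSet,
          inter_comm B A]
        ring
    _ ≤ volume (moved α A B \ B) + volume (moved (1 - α) B A \ A) + 1 * volume (A ∩ B) := by
        gcongr
    _ = volume ((moved α A B \ B) ∪ (moved (1 - α) B A \ A) ∪ A ∩ B) := by
        rw [measure_union hdis hW, measure_union₀ hYm.nullMeasurableSet hXY, one_mul]
    _ ≤ volume (morph α A B) := measure_mono hsub

/-! ### The case of equality -/

/-- Each target `c` pulls in its cell by a homothety of ratio `1 - α`. Two cells share only points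
of a perpendicular bisector, so the cell areas add up to at most that of `A`. -/
theorem volume_moved_le_of_finite {A B : Set Plane} (hA : IsCompact A) (hB : IsCompact B) (α : ℝ)
    (hfin : {c | ∃ a ∈ A, IsClosest B a c}.Finite) :
    volume (moved α A B) ≤ ENNReal.ofReal ((1 - α) ^ 2) * volume A := by
  set F := hfin.toFinset
  have hm : ∀ c, MeasurableSet {a | a ∈ A ∧ IsClosest B a c} := fun c =>
    (hA.isClosed.inter ((isClosed_setOf_isClosest hB.isClosed).preimage
      (f := fun a : Plane => (a, c)) (by fun_prop))).measurableSet
  have hdis : (F : Set Plane).Pairwise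
      (Function.onFun (AEDisjoint volume) fun c => {a | a ∈ A ∧ IsClosest B a c}) := by
    intro c _ c' _ hne
    refine measure_mono_null ?_ (Measure.addHaar_affineSubspace volume
      (AffineSubspace.perpBisector c c') fun h => hne (AffineSubspace.perpBisector_eq_top.1 h))
    rintro a ⟨⟨-, h⟩, -, h'⟩
    exact AffineSubspace.mem_perpBisector_iff_dist_eq.2
      (le_antisymm (h.2 _ h'.1) (h'.2 _ h.1))
  have hsub : moved α A B ⊆
      ⋃ c ∈ F, AffineMap.homothety c (1 - α) '' {a | a ∈ A ∧ IsClosest B a c} := by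
    rintro x ⟨a, ha, c, hc, rfl⟩
    refine mem_biUnion (x := c) (hfin.mem_toFinset.2 ⟨a, ha, hc⟩) ⟨a, ⟨ha, hc⟩, ?_⟩
    rw [AffineMap.homothety_apply, vsub_eq_sub, vadd_eq_add]
    module
  calc volume (moved α A B)
      ≤ ∑ c ∈ F, volume (AffineMap.homothety c (1 - α) '' {a | a ∈ A ∧ IsClosest B a c}) :=
        (measure_mono hsub).trans (measure_biUnion_finset_le _ _)
    _ = ∑ c ∈ F, ENNReal.ofReal ((1 - α) ^ 2) * volume {a | a ∈ A ∧ IsClosest B a c} := by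
        refine Finset.sum_congr rfl fun c _ => ?_
        rw [Measure.addHaar_image_homothety, finrank_euclideanSpace_fin, abs_sq]
    _ = ENNReal.ofReal ((1 - α) ^ 2) * volume (⋃ c ∈ F, {a | a ∈ A ∧ IsClosest B a c}) := by
        rw [← Finset.mul_sum, measure_biUnion_finset₀ hdis fun c _ => (hm c).nullMeasurableSet]
    _ ≤ ENNReal.ofReal ((1 - α) ^ 2) * volume A := by
        gcongr
        exact iUnion₂_subset fun c _ a ha => ha.1

theorem volume_morph_le_of_finite {A B : Set Plane} (hA : IsCompact A) (hB : IsCompact B) (α : ℝ)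
    (hfin : {c | ∃ a ∈ A, IsClosest B a c}.Finite)
    (hfin' : {c | ∃ b ∈ B, IsClosest A b c}.Finite) :
    volume (morph α A B) ≤
      ENNReal.ofReal ((1 - α) ^ 2) * volume A + ENNReal.ofReal (α ^ 2) * volume B := by
  refine (measure_union_le _ _).trans (add_le_add (volume_moved_le_of_finite hA hB α hfin) ?_)
  simpa using volume_moved_le_of_finite hB hA (1 - α) hfin'

end VoronoiMorph

theorem mainTheorem6 :
    (∀ (A B : VoronoiMorph.PolygonalShape) (α : ℝ), 0 ≤ α → α ≤ 1 →
      -- the pieces cover the shapes, and the scaled pieces make up the morph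
      (⋃ s ∈ B.sites, VoronoiMorph.piece A B s) = A.carrier ∧
      (⋃ t ∈ A.sites, VoronoiMorph.piece B A t) = B.carrier ∧
      VoronoiMorph.morph α A.carrier B.carrier =
        (⋃ s ∈ B.sites, VoronoiMorph.scaledPiece α A B s) ∪
          (⋃ t ∈ A.sites, VoronoiMorph.scaledPiece (1 - α) B A t) ∧
      -- two scaled pieces of the same shape
      (∀ s ∈ B.sites, ∀ s' ∈ B.sites, s ≠ s' → VoronoiMorph.InteriorDisjoint
        (VoronoiMorph.scaledPiece α A B s) (VoronoiMorph.scaledPiece α A B s')) ∧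
      (∀ t ∈ A.sites, ∀ t' ∈ A.sites, t ≠ t' → VoronoiMorph.InteriorDisjoint
        (VoronoiMorph.scaledPiece (1 - α) B A t) (VoronoiMorph.scaledPiece (1 - α) B A t')) ∧
      -- a scaled piece of one shape and a scaled piece of the other
      (∀ s ∈ B.sites, ∀ t ∈ A.sites, ¬ (s.IsFace ∧ t.IsFace) → VoronoiMorph.InteriorDisjoint
        (VoronoiMorph.scaledPiece α A B s) (VoronoiMorph.scaledPiece (1 - α) B A t)) ∧
      -- all scaled pieces of one shape together, and all those of the other
      interior (⋃ s ∈ B.sites, VoronoiMorph.scaledPiece α A B s) ∩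
          interior (⋃ t ∈ A.sites, VoronoiMorph.scaledPiece (1 - α) B A t) =
        interior A.carrier ∩ interior B.carrier) ∧
    (∀ (A B : Set VoronoiMorph.Plane), IsCompact A → IsCompact B → A.Nonempty → B.Nonempty →
      ∀ α : ℝ, 0 ≤ α → α ≤ 1 →
        -- the lower bound on the area
        ENNReal.ofReal ((1 - α) ^ 2) * MeasureTheory.volume A +
            ENNReal.ofReal (α ^ 2) * MeasureTheory.volume B ≤
          MeasureTheory.volume (VoronoiMorph.morph α A B) ∧
        -- it is attained if the shapes are disjoint and all parts move to finitely many points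
        (Disjoint A B →
          {c | ∃ a ∈ A, VoronoiMorph.IsClosest B a c}.Finite →
          {c | ∃ b ∈ B, VoronoiMorph.IsClosest A b c}.Finite →
          MeasureTheory.volume (VoronoiMorph.morph α A B) =
            ENNReal.ofReal ((1 - α) ^ 2) * MeasureTheory.volume A +
              ENNReal.ofReal (α ^ 2) * MeasureTheory.volume B)) := by
  open VoronoiMorph in
  refine ⟨fun A B α h0 h1 => ⟨iUnion_piece A B, iUnion_piece B A, ?_, ?_, ?_, ?_, ?_⟩,
    fun A B hA hB hAne hBne α h0 h1 => ⟨le_volume_morph hA hB hAne hBne h0 h1, ?_⟩⟩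
  · rw [iUnion_scaledPiece, iUnion_scaledPiece, morph]
  · exact fun s hs s' hs' hne => interiorDisjoint_scaledPiece h0 h1 A B hs hs' hne
  · exact fun t ht t' ht' hne =>
      interiorDisjoint_scaledPiece (sub_nonneg.2 h1) (by linarith) B A ht ht' hne
  · exact fun s hs t ht hst => interiorDisjoint_scaledPiece_scaledPiece h0 h1 A B hs ht hst
  · rw [iUnion_scaledPiece, iUnion_scaledPiece, interior_moved_inter_eq h0 h1]
  · exact fun _ hfin hfin' => le_antisymm (volume_morph_le_of_finite hA hB α hfin hfin')
      (le_volume_morph hA hB hAne hBne h0 h1)
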